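/- Let $\mathbb{F}=\{0,1\}$ with addition $\oplus$ modulo $2$. A function $f:\mathbb{F}^n\to\mathbb{F}$ is called bent if $\sum_{x\in\mathbb{F}^n}(-1)^{f(x)\oplus\langle x,y\rangle}=\pm 2^{n/2}$ for every $y\in\mathbb{F}^n$, and balanced if it takes the values $0$ and $1$ equally often; its algebraic degree is the degree of the unique multilinear polynomial over the two-element field that represents it. The derivative of $f$ in the direction $a\in\mathbb{F}^n$ is $D_af(x)=f(x)\oplus f(x\oplus a)$; if $e$ is the $i$-th standard basis vector, then $D_ef$ does not depend on the $i$-th coordinate and is regarded as a function of the other $n-1$ variables. Theorem. For all sufficiently large even $n$ there exists a balanced Boolean function $g$ in $n-1$ variables, of algebraic degree at most $n/2-1$, such that $g\ne D_ef$ for every $n$-variable bent function $f$ and every standard basis vector $e$. Consequently, for all sufficiently large even $n$ Tokareva's conjecture fails: it is not true that every balanced Boolean function $g$ in $n$ variables, of algebraic degree at most $n/2-1$ and satisfying $g(x)=g(x\oplus y)$ for all $x$ and some nonzero $y$, is equal to $D_af$ for some $n$-variable bent function $f$ and some $a\in\mathbb{F}^n$. -/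

import Mathlib

/-- Boolean functions in `n` variables, with values in the two-element field. -/
abbrev BoolFun (n : ℕ) : Type := (Fin n → ZMod 2) → ZMod 2

namespace BoolFun

/-- `f` takes the values `0` and `1` equally often. -/
def IsBalanced {n : ℕ} (f : BoolFun n) : Prop :=
  (Finset.univ.filter fun x => f x = 0).card = (Finset.univ.filter fun x => f x = 1).card

/-- The Walsh–Hadamard transform `W_f(y) = ∑ₓ (-1)^(f(x) ⊕ ⟨x, y⟩)`. -/
def walsh {n : ℕ} (f : BoolFun n) (y : Fin n → ZMod 2) : ℤ :=
  ∑ x : Fin n → ZMod 2, (-1) ^ (f x + ∑ i, x i * y i).val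

/-- `f` is bent: `W_f(y) = ± 2^(n/2)` for all `y` (with the real exponent `n/2`). -/
def IsBent {n : ℕ} (f : BoolFun n) : Prop :=
  ∀ y, (walsh f y : ℝ) = (2 : ℝ) ^ ((n : ℝ) / 2) ∨ (walsh f y : ℝ) = -(2 : ℝ) ^ ((n : ℝ) / 2)

/-- The derivative `D_a f (x) = f(x) ⊕ f(x ⊕ a)`. -/
def derivative {n : ℕ} (a : Fin n → ZMod 2) (f : BoolFun n) : BoolFun n :=
  fun x => f x + f (x + a)

/-- The derivative in the direction of the `i`-th unit vector `e` does not depend on the `i`-th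
coordinate; this is `D_e f` as a function of the remaining `n` variables. -/
def coordDerivative {n : ℕ} (i : Fin (n + 1)) (f : BoolFun (n + 1)) : BoolFun n :=
  fun z => derivative (Pi.single i 1) f (i.insertNth 0 z)

/-- The 0/1-vector with support `S`. -/
def point {n : ℕ} (S : Finset (Fin n)) : Fin n → ZMod 2 := fun i => if i ∈ S then 1 else 0

/-- The Möbius transform of `f`: the coefficient of the monomial `∏ i ∈ S, xᵢ` in the
Boolean polynomial of `f`. -/
def anf {n : ℕ} (f : BoolFun n) (S : Finset (Fin n)) : ZMod 2 :=
  ∑ T ∈ S.powerset, f (point T)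

/-- The algebraic degree of `f`: the largest size of a monomial in its Boolean polynomial. -/
def algebraicDegree {n : ℕ} (f : BoolFun n) : ℕ :=
  (Finset.univ.filter fun S => anf f S ≠ 0).sup Finset.card

/-- `D_e f` is determined by `coordDerivative`, for `e` the `i`-th unit vector. -/
theorem derivative_single {n : ℕ} (i : Fin (n + 1)) (f : BoolFun (n + 1))
    (x : Fin (n + 1) → ZMod 2) :
    derivative (Pi.single i 1) f x = coordDerivative i f (i.removeNth x) := by
  have key : ∀ c : ZMod 2, c = 0 ∨ c = 1 := by decide
  have h2 : (1 + 1 : ZMod 2) = 0 := by decide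
  unfold coordDerivative derivative
  have e0 : (i.insertNth (0 : ZMod 2) (i.removeNth x) : Fin (n + 1) → ZMod 2)
      = Function.update x i 0 := by simp
  rw [e0]
  rcases key (x i) with h | h
  · have : Function.update x i 0 = x := by rw [← h]; simp
    rw [this]
  · have h1 : Function.update x i 0 = x + Pi.single i 1 := by
      ext j
      by_cases hj : j = i
      · subst hj; simp [h, h2]
      · simp [hj]
    have h3 : x + Pi.single i 1 + Pi.single i 1 = x := by
      rw [add_assoc, ← Pi.single_add, h2]; simp
    rw [h1, h3, add_comm]

/-- The Boolean polynomial with coefficients `anf f` represents `f`. -/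
theorem eq_sum_anf {n : ℕ} (f : BoolFun n) (x : Fin n → ZMod 2) :
    f x = ∑ S : Finset (Fin n), anf f S * ∏ i ∈ S, x i := by
  classical
  have key : ∀ c : ZMod 2, c = 0 ∨ c = 1 := by decide
  obtain ⟨X, rfl⟩ : ∃ X : Finset (Fin n), x = point X := by
    refine ⟨Finset.univ.filter fun i => x i = 1, ?_⟩
    ext i
    rcases key (x i) with h | h <;> simp [point, h]
  have hp : ∀ S : Finset (Fin n), ∏ i ∈ S, point X i = if S ⊆ X then 1 else 0 := by
    intro S
    simp only [point, Finset.prod_ite_zero, Finset.prod_const_one, Finset.subset_iff]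
  simp only [hp, anf, mul_ite, mul_one, mul_zero]
  have h1 : ∀ S : Finset (Fin n), (if S ⊆ X then ∑ T ∈ S.powerset, f (point T) else 0)
      = ∑ T : Finset (Fin n), if S ∈ Finset.Icc T X then f (point T) else 0 := by
    intro S
    split_ifs with h
    · rw [← Finset.sum_filter]
      refine Finset.sum_congr ?_ fun _ _ => rfl
      ext T
      simp [h]
    · simp [h]
  rw [Finset.sum_congr rfl fun S _ => h1 S, Finset.sum_comm]
  rw [Finset.sum_eq_single X]
  · simp
  · intro T _ hT
    rw [← Finset.sum_filter, Finset.sum_const, Finset.filter_mem_eq_inter, Finset.univ_inter]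
    by_cases hTX : T ⊆ X
    · rw [Finset.card_Icc_finset hTX]
      have : 0 < X.card - T.card :=
        Nat.sub_pos_of_lt (Finset.card_lt_card (Finset.ssubset_iff_subset_ne.2 ⟨hTX, hT⟩))
      have h2 : ((2 ^ (X.card - T.card) : ℕ) : ZMod 2) = 0 := by
        have h0 : (2 : ZMod 2) = 0 := by decide
        push_cast
        rw [h0, zero_pow this.ne']
      rw [nsmul_eq_mul, h2, zero_mul]
    · rw [Finset.Icc_eq_empty (by simpa using hTX)]
      simp
  · simp

/-- The coefficients of the Boolean polynomial of `f` are unique. -/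
theorem anf_unique {n : ℕ} (f : BoolFun n) (c : Finset (Fin n) → ZMod 2)
    (h : ∀ x, f x = ∑ S : Finset (Fin n), c S * ∏ i ∈ S, x i) : c = anf f := by
  classical
  let Φ : (Finset (Fin n) → ZMod 2) → BoolFun n :=
    fun c x => ∑ S : Finset (Fin n), c S * ∏ i ∈ S, x i
  have hs : Function.Surjective Φ := fun f => ⟨anf f, funext fun x => (eq_sum_anf f x).symm⟩
  have hb : Function.Bijective Φ := hs.bijective_of_nat_card_le (by simp)
  exact hb.1 (funext fun x => (h x).symm.trans (eq_sum_anf f x))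

/-- Tokareva's conjecture for functions in `n` variables: every balanced function of degree at most
`n/2 - 1` that is invariant under translation by some nonzero vector is a derivative (in some
direction) of a bent function. -/
def TokarevaConjecture (n : ℕ) : Prop :=
  ∀ g : BoolFun n, g.IsBalanced → g.algebraicDegree ≤ n / 2 - 1 →
    (∃ y : Fin n → ZMod 2, y ≠ 0 ∧ ∀ x, g x = g (x + y)) →
    ∃ (f : BoolFun n) (a : Fin n → ZMod 2), f.IsBent ∧ g = derivative a f

end BoolFun

/-! The proof is a count. Let `f` be bent in `2s+2` variables with `g = D_e f`, and let `g₀`, `g₁`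
be the halves of `g` on the `2s`-dimensional cube. For each pair `(α, β)`, the signed sum `E` of
`(-1)^f` over the planes spanned by `e` and one further basis direction has Fourier transform
`2^(s+1) (-1)^h`. As `E` is even valued, `h` has degree at most `s+1` (`sign_mem_reedMuller`). The
function `E` controls `g`: `g₀ ≠ g₁` exactly where `E = ±2`, and `g₀ = α` where `E = ±4`. If the
halves agree on half of the cube, then for some `(α, β)` the value `±4` has density at least `1/8`
(`exists_compatible`). Given `h` and `α`, it remains to choose `g₀` of degree at most `s` with known
values on a set of density `1/8`, which saves an eighth of the degrees of freedom
(`card_compatible_le`). Hence at most about `2^((1 + 7/8) 4^s / 2)` such `g` are derivatives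
(`card_derivatives_le`). Gluing balanced halves of degree at most `s-1` yields about `2^(4^s)`
balanced `g` of degree at most `s`, at least half of them with halves agreeing that often. So most
are not derivatives; functions with a nonzero period are also too few to matter. A `g` outside both
classes, with a dummy variable added, refutes Tokareva's conjecture. -/

namespace BoolFun

/-! ### Functions of bounded degree (Reed–Muller codes) -/

/-- The Boolean functions of algebraic degree at most `r`. -/
def reedMuller (n r : ℕ) : Finset (BoolFun n) :=
  Finset.univ.filter fun f => ∀ S : Finset (Fin n), r < S.card → anf f S = 0

/-- The subsets of `Fin n` with at most `r` elements. -/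
def smallSets (n r : ℕ) : Finset (Finset (Fin n)) :=
  Finset.univ.filter fun S => S.card ≤ r

theorem mem_reedMuller {n r : ℕ} {f : BoolFun n} :
    f ∈ reedMuller n r ↔ ∀ S : Finset (Fin n), r < S.card → anf f S = 0 := by
  simp [reedMuller]

theorem mem_smallSets {n r : ℕ} {S : Finset (Fin n)} : S ∈ smallSets n r ↔ S.card ≤ r := by
  simp [smallSets]

theorem algebraicDegree_le_iff {n r : ℕ} {f : BoolFun n} :
    f.algebraicDegree ≤ r ↔ f ∈ reedMuller n r := by
  rw [mem_reedMuller, algebraicDegree, Finset.sup_le_iff]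
  refine forall_congr' fun S => ?_
  rw [Finset.mem_filter, ← not_lt]
  simp only [Finset.mem_univ, true_and]
  tauto

/-- The monomial `∏ i ∈ S, xᵢ`. -/
def monomial {n : ℕ} (S : Finset (Fin n)) : BoolFun n := fun x => ∏ i ∈ S, x i

theorem anf_sum_monomial {n : ℕ} (c : Finset (Fin n) → ZMod 2) :
    anf (fun x => ∑ S : Finset (Fin n), c S * monomial S x) = c :=
  (anf_unique _ c fun _ => rfl).symm

theorem anf_add {n : ℕ} (f g : BoolFun n) (S : Finset (Fin n)) :
    anf (f + g) S = anf f S + anf g S := by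
  simp [anf, Finset.sum_add_distrib]

theorem anf_smul {n : ℕ} (c : ZMod 2) (f : BoolFun n) (S : Finset (Fin n)) :
    anf (c • f) S = c * anf f S := by
  simp [anf, Finset.mul_sum]

/-- The functions of degree at most `r`, as a subspace. -/
def reedMullerSubmodule (n r : ℕ) : Submodule (ZMod 2) (BoolFun n) where
  carrier := reedMuller n r
  add_mem' {f g} hf hg := by
    simp only [Finset.mem_coe, mem_reedMuller] at *
    intro S hS
    rw [anf_add, hf S hS, hg S hS, add_zero]
  zero_mem' := by simp [mem_reedMuller, anf]
  smul_mem' c f hf := by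
    simp only [Finset.mem_coe, mem_reedMuller] at *
    intro S hS
    rw [anf_smul, hf S hS, mul_zero]

theorem mem_reedMullerSubmodule {n r : ℕ} {f : BoolFun n} :
    f ∈ reedMullerSubmodule n r ↔ f ∈ reedMuller n r := Iff.rfl

theorem reedMuller_mono {n r t : ℕ} (h : r ≤ t) : reedMuller n r ⊆ reedMuller n t := by
  intro f hf
  rw [mem_reedMuller] at *
  exact fun S hS => hf S (by omega)

theorem add_mem_reedMuller {n r : ℕ} {f g : BoolFun n} (hf : f ∈ reedMuller n r)
    (hg : g ∈ reedMuller n r) : f + g ∈ reedMuller n r :=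
  (reedMullerSubmodule n r).add_mem hf hg

theorem monomial_mem_reedMuller {n r : ℕ} {S : Finset (Fin n)} (hS : S.card ≤ r) :
    monomial S ∈ reedMuller n r := by
  have h : monomial S = fun x => ∑ T : Finset (Fin n), (Pi.single S 1 : _ → ZMod 2) T *
      monomial T x := by
    funext x
    simp [Pi.single_apply]
  rw [mem_reedMuller, h, anf_sum_monomial]
  intro T hT
  rw [Pi.single_apply, if_neg]
  rintro rfl
  omega

theorem one_mem_reedMuller (n r : ℕ) : (1 : BoolFun n) ∈ reedMuller n r := by
  have := monomial_mem_reedMuller (n := n) (r := r) (S := ∅) (by simp)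
  have h : monomial (∅ : Finset (Fin n)) = 1 := by
    funext x
    simp [monomial]
  rwa [h] at this

theorem translate_mem_reedMuller {n r : ℕ} {f : BoolFun n} (hf : f ∈ reedMuller n r)
    (v : Fin n → ZMod 2) : (fun x => f (x + v)) ∈ reedMuller n r := by
  have h : (fun x => f (x + v)) = ∑ S : Finset (Fin n), anf f S •
      ∑ T ∈ S.powerset, (∏ i ∈ S \ T, v i) • monomial T := by
    funext x
    rw [eq_sum_anf f]
    simp only [Pi.add_apply, Finset.prod_add, Finset.sum_apply, Pi.smul_apply, smul_eq_mul,
      monomial]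
    refine Finset.sum_congr rfl fun S _ => ?_
    congr 1
    exact Finset.sum_congr rfl fun T _ => mul_comm _ _
  rw [h, ← mem_reedMullerSubmodule]
  refine Submodule.sum_mem _ fun S _ => ?_
  by_cases hS : r < S.card
  · rw [mem_reedMuller.1 hf S hS, zero_smul]
    exact Submodule.zero_mem _
  · refine Submodule.smul_mem _ _ (Submodule.sum_mem _ fun T hT => Submodule.smul_mem _ _ ?_)
    have := Finset.card_le_card (Finset.mem_powerset.1 hT)
    exact monomial_mem_reedMuller (by omega)

theorem eq_of_anf_eq {n : ℕ} {f g : BoolFun n} (h : anf f = anf g) : f = g := by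
  funext x
  rw [eq_sum_anf f, eq_sum_anf g, h]

/-- A coefficient at `S` only involves values at points supported inside `S`, so the points of
weight at most `r` form an information set. -/
theorem eq_of_eq_on_points {n r : ℕ} {f g : BoolFun n} (hf : f ∈ reedMuller n r)
    (hg : g ∈ reedMuller n r) (h : ∀ S : Finset (Fin n), S.card ≤ r → f (point S) = g (point S)) :
    f = g := by
  refine eq_of_anf_eq (funext fun S => ?_)
  by_cases hS : r < S.card
  · rw [mem_reedMuller.1 hf S hS, mem_reedMuller.1 hg S hS]
  · refine Finset.sum_congr rfl fun T hT => h T ?_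
    have := Finset.card_le_card (Finset.mem_powerset.1 hT)
    omega

theorem card_reedMuller (n r : ℕ) : (reedMuller n r).card = 2 ^ (smallSets n r).card := by
  have h : ((smallSets n r).powerset).card = 2 ^ (smallSets n r).card := Finset.card_powerset _
  rw [← h]
  symm
  have key : ∀ c : ZMod 2, c ≠ 0 → c = 1 := by decide
  refine Finset.card_bij'
    (fun A _ => fun x => ∑ S : Finset (Fin n), (if S ∈ A then 1 else 0) * monomial S x)
    (fun f _ => Finset.univ.filter fun S => anf f S ≠ 0) ?_ ?_ ?_ ?_
  · intro A hA
    rw [mem_reedMuller, anf_sum_monomial]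
    intro S hS
    rw [if_neg]
    intro h
    have := mem_smallSets.1 (Finset.mem_powerset.1 hA h)
    omega
  · intro f hf
    rw [Finset.mem_powerset]
    intro S hS
    rw [mem_smallSets]
    by_contra hc
    exact (Finset.mem_filter.1 hS).2 (mem_reedMuller.1 hf S (by omega))
  · intro A hA
    rw [anf_sum_monomial]
    ext S
    simp
  · intro f hf
    funext x
    rw [eq_sum_anf f x]
    refine Finset.sum_congr rfl fun S _ => ?_
    congr 1
    by_cases h : anf f S = 0
    · simp [h]
    · simp [key _ h]

theorem point_map_succAbove {n : ℕ} (i : Fin (n + 1)) (S : Finset (Fin n)) :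
    point (S.map i.succAboveEmb) = i.insertNth (0 : ZMod 2) (point S) := by
  funext j
  refine Fin.succAboveCases i ?_ (fun j => ?_) j
  · simp [point, Fin.succAbove_ne]
  · simp [point]

theorem sum_powerset_map {α β M : Type*} [DecidableEq β] [AddCommMonoid M] (e : α ↪ β)
    (S : Finset α) (F : Finset β → M) :
    ∑ T ∈ (S.map e).powerset, F T = ∑ T ∈ S.powerset, F (T.map e) := by
  symm
  refine Finset.sum_bij (fun T _ => T.map e) ?_ ?_ ?_ fun _ _ => rfl
  · intro T hT
    simpa using hT
  · intro T _ T' _ h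
    exact Finset.map_injective e h
  · intro T hT
    rw [Finset.mem_powerset, Finset.subset_map_iff] at hT
    obtain ⟨U, hU, rfl⟩ := hT
    exact ⟨U, Finset.mem_powerset.2 hU, rfl⟩

theorem anf_insertNth_zero {n : ℕ} (i : Fin (n + 1)) (g : BoolFun (n + 1)) (S : Finset (Fin n)) :
    anf (fun x => g (i.insertNth (0 : ZMod 2) x)) S = anf g (S.map i.succAboveEmb) := by
  simp only [anf, sum_powerset_map, point_map_succAbove]

theorem restrict_mem_reedMuller {n r : ℕ} {g : BoolFun (n + 1)} (hg : g ∈ reedMuller (n + 1) r)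
    (i : Fin (n + 1)) : (fun x => g (i.insertNth (0 : ZMod 2) x)) ∈ reedMuller n r := by
  rw [mem_reedMuller] at *
  intro S hS
  rw [anf_insertNth_zero]
  exact hg _ (by simpa using hS)

/-! ### Gluing two halves -/

/-- The function that equals `a` where the first coordinate vanishes and `b` elsewhere. -/
def glue {n : ℕ} (a b : BoolFun n) : BoolFun (n + 1) :=
  fun x => if x 0 = 0 then a (Fin.tail x) else b (Fin.tail x)

theorem glue_cons_zero {n : ℕ} (a b : BoolFun n) (x : Fin n → ZMod 2) :
    glue a b (Fin.cons 0 x) = a x := by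
  simp [glue]

theorem glue_cons_one {n : ℕ} (a b : BoolFun n) (x : Fin n → ZMod 2) :
    glue a b (Fin.cons 1 x) = b x := by
  simp [glue]

theorem glue_injective {n : ℕ} {a b c d : BoolFun n} (h : glue a b = glue c d) :
    a = c ∧ b = d := by
  constructor <;> funext x
  · rw [← glue_cons_zero a b, h, glue_cons_zero]
  · rw [← glue_cons_one a b, h, glue_cons_one]

theorem glue_eq {n : ℕ} (g : BoolFun (n + 1)) :
    glue (fun x => g (Fin.cons 0 x)) (fun x => g (Fin.cons 1 x)) = g := by
  have key : ∀ c : ZMod 2, c ≠ 0 → c = 1 := by decide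
  funext x
  unfold glue
  split_ifs with h
  · change g (Fin.cons 0 (Fin.tail x)) = g x
    rw [← h, Fin.cons_self_tail]
  · change g (Fin.cons 1 (Fin.tail x)) = g x
    rw [← key _ h, Fin.cons_self_tail]

theorem anf_glue {n : ℕ} (a b : BoolFun n) (S : Finset (Fin n)) :
    anf (glue a b) (insert 0 (S.map (Fin.succEmb n))) = anf a S + anf b S := by
  have h0 : (0 : Fin (n + 1)) ∉ S.map (Fin.succEmb n) := by simp
  have hp : ∀ T : Finset (Fin n), point (T.map (Fin.succEmb n)) = Fin.cons 0 (point T) := by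
    intro T
    funext j
    refine Fin.cases ?_ (fun j => ?_) j <;> simp [point]
  have hq : ∀ T : Finset (Fin n),
      point (insert 0 (T.map (Fin.succEmb n))) = Fin.cons 1 (point T) := by
    intro T
    funext j
    refine Fin.cases ?_ (fun j => ?_) j <;> simp [point]
  unfold anf
  rw [Finset.sum_powerset_insert h0]
  simp only [sum_powerset_map, hp, hq, glue_cons_zero, glue_cons_one]

theorem anf_glue_map {n : ℕ} (a b : BoolFun n) (S : Finset (Fin n)) :
    anf (glue a b) (S.map (Fin.succEmb n)) = anf a S := by
  have hp : ∀ T : Finset (Fin n), point (T.map (Fin.succEmb n)) = Fin.cons 0 (point T) := by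
    intro T
    funext j
    refine Fin.cases ?_ (fun j => ?_) j <;> simp [point]
  unfold anf
  simp only [sum_powerset_map, hp, glue_cons_zero]

/-- A monomial containing the new variable has degree `S.card + 1`, hence the non-strict bound in
`hab`. -/
theorem glue_mem_of_anf {n r : ℕ} {a b : BoolFun n} (ha : a ∈ reedMuller n r)
    (hab : ∀ S : Finset (Fin n), r ≤ S.card → anf a S + anf b S = 0) :
    glue a b ∈ reedMuller (n + 1) r := by
  rw [mem_reedMuller] at *
  intro S hS
  obtain ⟨T, hT⟩ : ∃ T : Finset (Fin n), S.erase 0 = T.map (Fin.succEmb n) := by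
    refine ⟨Finset.univ.filter fun j => j.succ ∈ S, ?_⟩
    ext j
    refine Fin.cases ?_ (fun j => ?_) j <;> simp
  by_cases h0 : (0 : Fin (n + 1)) ∈ S
  · have hc := Finset.card_erase_of_mem h0
    rw [hT, Finset.card_map] at hc
    rw [← Finset.insert_erase h0, hT, anf_glue]
    exact hab T (by omega)
  · rw [Finset.erase_eq_of_notMem h0] at hT
    subst hT
    rw [anf_glue_map]
    exact ha T (by simpa using hS)

theorem glue_mem_reedMuller {n r : ℕ} {a b : BoolFun n} (ha : a ∈ reedMuller n r)
    (hb : b ∈ reedMuller n r) : glue a b ∈ reedMuller (n + 1) (r + 1) := by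
  refine glue_mem_of_anf (reedMuller_mono (Nat.le_succ r) ha) fun S hS => ?_
  rw [mem_reedMuller.1 ha S hS, mem_reedMuller.1 hb S hS, add_zero]

theorem glue_self_mem_reedMuller {n r : ℕ} {a : BoolFun n} (ha : a ∈ reedMuller n r) :
    glue a a ∈ reedMuller (n + 1) r :=
  glue_mem_of_anf ha fun _ _ => CharTwo.add_self_eq_zero _

/-! ### Fourier inversion and the degree of sign functions -/

/-- The character `(-1)^a`. -/
def sgn (a : ZMod 2) : ℤ := (-1) ^ a.val

theorem sgn_add (a b : ZMod 2) : sgn (a + b) = sgn a * sgn b := by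
  revert a b
  decide

theorem sgn_zero : sgn 0 = 1 := rfl

theorem sgn_eq_one_sub (a : ZMod 2) : sgn a = 1 - 2 * (a.val : ℤ) := by
  revert a
  decide

theorem sgn_sum {ι : Type*} (A : Finset ι) (c : ι → ZMod 2) :
    sgn (∑ i ∈ A, c i) = ∏ i ∈ A, sgn (c i) := by
  classical
  induction A using Finset.induction_on with
  | empty => simp [sgn_zero]
  | insert a A ha ih => rw [Finset.sum_insert ha, Finset.prod_insert ha, sgn_add, ih]

/-- The Fourier transform of an integer valued function. -/
def fourier {m : ℕ} (E : (Fin m → ZMod 2) → ℤ) (y : Fin m → ZMod 2) : ℤ :=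
  ∑ x, E x * sgn (∑ i, x i * y i)

theorem sum_sgn_inner {m : ℕ} (x : Fin m → ZMod 2) :
    ∑ y : Fin m → ZMod 2, sgn (∑ i, x i * y i) = if x = 0 then 2 ^ m else 0 := by
  have h1 : ∀ c : ZMod 2, ∑ t : ZMod 2, sgn (c * t) = if c = 0 then 2 else 0 := by decide
  have h : ∑ y : Fin m → ZMod 2, sgn (∑ i, x i * y i) = ∏ i, ∑ t : ZMod 2, sgn (x i * t) := by
    rw [Fintype.prod_sum]
    exact Finset.sum_congr rfl fun y _ => sgn_sum _ _
  rw [h]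
  simp only [h1]
  split_ifs with hx
  · simp [hx]
  · obtain ⟨i, hi⟩ := Function.ne_iff.1 hx
    exact Finset.prod_eq_zero (Finset.mem_univ i) (if_neg hi)

theorem fourier_fourier {m : ℕ} (E : (Fin m → ZMod 2) → ℤ) (x : Fin m → ZMod 2) :
    fourier (fourier E) x = 2 ^ m * E x := by
  have h : ∀ y z : Fin m → ZMod 2, E z * sgn (∑ i, z i * y i) * sgn (∑ i, y i * x i)
      = E z * sgn (∑ i, (z + x) i * y i) := by
    intro y z
    rw [mul_assoc, ← sgn_add, ← Finset.sum_add_distrib]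
    congr 2
    exact Finset.sum_congr rfl fun i _ => by simp only [Pi.add_apply]; ring
  unfold fourier
  simp only [Finset.sum_mul, h]
  rw [Finset.sum_comm]
  simp only [← Finset.mul_sum, sum_sgn_inner]
  rw [Finset.sum_eq_single x]
  · have : x + x = 0 := by
      funext i
      exact CharTwo.add_self_eq_zero _
    rw [if_pos this, mul_comm]
  · intro z _ hz
    rw [if_neg, mul_zero]
    intro h0
    refine hz (funext fun i => ?_)
    have := congrFun h0 i
    exact CharTwo.add_eq_zero.1 this
  · simp

/-- The integer valued function whose Fourier transform is `2 ^ t * (-1) ^ h`, if there is one. -/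
def ofSign {m : ℕ} (t : ℕ) (h : BoolFun m) (x : Fin m → ZMod 2) : ℤ :=
  fourier (fun y => 2 ^ t * sgn (h y)) x / 2 ^ m

theorem eq_ofSign {m t : ℕ} {E : (Fin m → ZMod 2) → ℤ} {h : BoolFun m}
    (hE : ∀ y, fourier E y = 2 ^ t * sgn (h y)) : E = ofSign t h := by
  funext x
  have : fourier E = fun y => 2 ^ t * sgn (h y) := funext hE
  rw [ofSign, ← this, fourier_fourier, Int.mul_ediv_cancel_left _ (by positivity)]

/-- Summed over `T ⊆ S`, the characters factor as `∏ i ∈ S, (1 + (-1)^xᵢ)` with every factor `0` or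
`2`; the evenness of `E` gives one more factor `2`. -/
theorem dvd_sum_fourier {m : ℕ} {E : (Fin m → ZMod 2) → ℤ} (hE : ∀ x, 2 ∣ E x)
    (S : Finset (Fin m)) : (2 ^ (S.card + 1) : ℤ) ∣ ∑ T ∈ S.powerset, fourier E (point T) := by
  have h2 : ∀ c : ZMod 2, (2 : ℤ) ∣ 1 + sgn c := by decide
  have h : ∀ (x : Fin m → ZMod 2) (T : Finset (Fin m)), sgn (∑ i, x i * point T i) = ∏ i ∈ T, sgn (x i) := by
    intro x T
    rw [← sgn_sum]
    simp [point, Finset.sum_ite_mem]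
  unfold fourier
  rw [Finset.sum_comm]
  simp only [h, ← Finset.mul_sum, ← Finset.prod_one_add]
  refine Finset.dvd_sum fun x _ => ?_
  rw [pow_succ']
  refine mul_dvd_mul (hE x) ?_
  rw [← Finset.prod_const]
  exact Finset.prod_dvd_prod_of_dvd _ _ fun i _ => h2 _

/-- For `|S| > t`, cancelling `2^t` in `dvd_sum_fourier` leaves `4 ∣ ∑ (-1)^h` over the points below
`S`. Since `(-1)^h = 1 - 2h` and `4 ∣ 2^|S|`, the sum of `h` there is even: the coefficient at `S`
vanishes. -/
theorem sign_mem_reedMuller {m t : ℕ} (ht : 1 ≤ t) {E : (Fin m → ZMod 2) → ℤ} {h : BoolFun m}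
    (h2 : ∀ x, 2 ∣ E x) (hE : ∀ y, fourier E y = 2 ^ t * sgn (h y)) : h ∈ reedMuller m t := by
  rw [mem_reedMuller]
  intro S hS
  have h1 := dvd_sum_fourier h2 S
  simp only [hE] at h1
  rw [← Finset.mul_sum, show S.card + 1 = t + (S.card + 1 - t) by omega, pow_add] at h1
  have h3 := Int.dvd_of_mul_dvd_mul_left (by positivity) h1
  have h4 : (2 ^ 2 : ℤ) ∣ ∑ T ∈ S.powerset, sgn (h (point T)) :=
    (pow_dvd_pow 2 (by omega)).trans h3
  simp only [sgn_eq_one_sub, Finset.sum_sub_distrib, ← Finset.mul_sum] at h4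
  rw [Finset.sum_const, Finset.card_powerset, nsmul_eq_mul, mul_one] at h4
  push_cast at h4
  have h5 : (2 ^ 2 : ℤ) ∣ 2 ^ S.card := pow_dvd_pow 2 (by omega)
  have h6 := (Int.dvd_iff_dvd_of_dvd_sub h4).1 h5
  have h7 : (2 : ℤ) ∣ ((∑ T ∈ S.powerset, (h (point T)).val : ℕ) : ℤ) := by
    push_cast
    omega
  have h8 := (ZMod.natCast_eq_zero_iff _ 2).2 (Int.natCast_dvd_natCast.1 (by exact_mod_cast h7))
  rw [Nat.cast_sum] at h8
  simpa [anf] using h8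

/-! ### Plane sums of bent functions -/

/-- The vector with `i`-th coordinate `p`, first other coordinate `q` and remaining part `x`. -/
def insertTwo {m : ℕ} (i : Fin (m + 2)) (p q : ZMod 2) (x : Fin m → ZMod 2) :
    Fin (m + 2) → ZMod 2 :=
  i.insertNth p (Fin.cons q x : Fin (m + 1) → ZMod 2)

theorem sum_insertTwo {m : ℕ} (i : Fin (m + 2)) (F : (Fin (m + 2) → ZMod 2) → ℤ) :
    ∑ x, F x = ∑ p, ∑ q, ∑ x, F (insertTwo i p q x) := by
  rw [← (Fin.insertNthEquiv (fun _ => ZMod 2) i).sum_comp, Fintype.sum_prod_type]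
  refine Finset.sum_congr rfl fun p _ => ?_
  rw [← (Fin.consEquiv (fun _ => ZMod 2)).sum_comp, Fintype.sum_prod_type]
  rfl

/-- The sum over the first two coordinates of `(-1)^(f + ⟨(p, q), (α, β)⟩)`. -/
def planeSum {m : ℕ} (f : BoolFun (m + 2)) (i : Fin (m + 2)) (α β : ZMod 2)
    (x : Fin m → ZMod 2) : ℤ :=
  ∑ p, ∑ q, sgn (f (insertTwo i p q x) + (p * α + q * β))

theorem inner_insertTwo {m : ℕ} (i : Fin (m + 2)) (p q α β : ZMod 2) (x y : Fin m → ZMod 2) :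
    ∑ k, insertTwo i p q x k * insertTwo i α β y k = p * α + q * β + ∑ k, x k * y k := by
  rw [Fin.sum_univ_succAbove _ i, add_assoc]
  simp [insertTwo, Fin.sum_univ_succ]

theorem fourier_planeSum {m : ℕ} (f : BoolFun (m + 2)) (i : Fin (m + 2)) (α β : ZMod 2)
    (y : Fin m → ZMod 2) : fourier (planeSum f i α β) y = walsh f (insertTwo i α β y) := by
  have h : walsh f (insertTwo i α β y)
      = ∑ x, sgn (f x + ∑ k, x k * insertTwo i α β y k) := rfl
  rw [h, sum_insertTwo i]
  unfold fourier planeSum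
  simp only [Finset.sum_mul, inner_insertTwo, ← sgn_add, ← add_assoc]
  rw [Finset.sum_comm]
  exact Finset.sum_congr rfl fun p _ => Finset.sum_comm

theorem IsBent.walsh_eq {s : ℕ} {f : BoolFun (2 * s + 2)} (hf : f.IsBent)
    (y : Fin (2 * s + 2) → ZMod 2) : walsh f y = 2 ^ (s + 1) ∨ walsh f y = -2 ^ (s + 1) := by
  have h : (2 : ℝ) ^ (((2 * s + 2 : ℕ) : ℝ) / 2) = 2 ^ (s + 1) := by
    rw [← Real.rpow_natCast]
    congr 1
    push_cast
    ring
  have := hf y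
  rw [h] at this
  exact_mod_cast this

theorem planeSum_eq {m : ℕ} (f : BoolFun (m + 2)) (i : Fin (m + 2)) (α β : ZMod 2)
    (x : Fin m → ZMod 2) : planeSum f i α β x =
      sgn (f (insertTwo i 0 0 x)) + sgn (f (insertTwo i 0 1 x) + β) +
      (sgn (f (insertTwo i 1 0 x) + α) + sgn (f (insertTwo i 1 1 x) + (α + β))) := by
  have h : ∀ F : ZMod 2 → ℤ, ∑ p, F p = F 0 + F 1 := fun F => Fin.sum_univ_two F
  simp [planeSum, h]

theorem IsBent.exists_sign {s : ℕ} {f : BoolFun (2 * s + 2)} (hf : f.IsBent)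
    (i : Fin (2 * s + 2)) (α β : ZMod 2) :
    ∃ h ∈ reedMuller (2 * s) (s + 1), planeSum f i α β = ofSign (s + 1) h := by
  let h : BoolFun (2 * s) := fun y => if walsh f (insertTwo i α β y) = 2 ^ (s + 1) then 0 else 1
  have hE : ∀ y, fourier (planeSum f i α β) y = 2 ^ (s + 1) * sgn (h y) := by
    intro y
    rw [fourier_planeSum]
    simp only [h]
    split_ifs with h0
    · rw [h0, sgn_zero, mul_one]
    · rw [(hf.walsh_eq _).resolve_left h0, show sgn 1 = -1 from rfl]
      ring
  refine ⟨h, sign_mem_reedMuller (by omega) ?_ hE, eq_ofSign hE⟩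
  have key : ∀ a b c d : ZMod 2, (2 : ℤ) ∣ sgn a + sgn b + (sgn c + sgn d) := by decide
  intro x
  rw [planeSum_eq]
  exact key _ _ _ _

theorem coordDerivative_cons {m : ℕ} (f : BoolFun (m + 2)) (i : Fin (m + 2)) (q : ZMod 2)
    (x : Fin m → ZMod 2) : coordDerivative i f (Fin.cons q x)
      = f (insertTwo i 0 q x) + f (insertTwo i 1 q x) := by
  unfold coordDerivative derivative insertTwo
  congr 2
  funext j
  refine Fin.succAboveCases i ?_ (fun j => ?_) j <;> simp

/-- Here `a, b, c, d` are the values of `f` at `(p, q) = (0,0), (0,1), (1,0), (1,1)`, so `a + c` and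
`b + d` are the values of the two halves of the derivative. -/
theorem four_signs (a b c d α β : ZMod 2) :
    let E := sgn a + sgn (b + β) + (sgn (c + α) + sgn (d + (α + β)))
    (b + d = a + c + if E = 2 ∨ E = -2 then 1 else 0) ∧
      (E = 4 ∨ E = -4 → a + c = α) := by
  revert a b c d α β
  decide

/-- Taking `α = a + c` and `β = a + b` makes all four signs equal. -/
theorem exists_four_signs (a b c d : ZMod 2) (h : a + c = b + d) : ∃ α β : ZMod 2,
    let E := sgn a + sgn (b + β) + (sgn (c + α) + sgn (d + (α + β)))
    E = 4 ∨ E = -4 := by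
  revert a b c d
  decide

/-! ### Counting coordinate derivatives -/

/-- Average over `v`: each `b i + v` lies in `P` for exactly `P.card` shifts. -/
theorem exists_large_translate {V ι : Type*} [Fintype V] [AddCommGroup V] [DecidableEq V]
    (P : Finset V) (B : Finset ι) (b : ι → V) :
    ∃ v, P.card * B.card ≤ Fintype.card V * (B.filter fun i => b i + v ∈ P).card := by
  by_contra! hc
  have h1 : ∑ v : V, (B.filter fun i => b i + v ∈ P).card = P.card * B.card := by
    simp only [Finset.card_filter]
    rw [Finset.sum_comm, mul_comm, ← smul_eq_mul, ← Finset.sum_const]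
    refine Finset.sum_congr rfl fun i _ => ?_
    exact (Fintype.sum_equiv (Equiv.addLeft (b i)) _ (fun v => if v ∈ P then 1 else 0)
      fun _ => rfl).trans (by simp)
  have h2 : ∑ v : V, Fintype.card V * (B.filter fun i => b i + v ∈ P).card
      < ∑ v : V, P.card * B.card :=
    Finset.sum_lt_sum_of_nonempty Finset.univ_nonempty fun v _ => hc v
  rw [← Finset.mul_sum, h1, Finset.sum_const, smul_eq_mul, Finset.card_univ] at h2
  exact lt_irrefl _ h2

/-- The points where the two halves of `g` agree. -/
def agreement {n : ℕ} (g : BoolFun (n + 1)) : Finset (Fin n → ZMod 2) :=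
  Finset.univ.filter fun x => g (Fin.cons 0 x) = g (Fin.cons 1 x)

/-- The points where a plane sum with sign function `h` is `±4`. -/
def extremePoints {m : ℕ} (t : ℕ) (h : BoolFun m) : Finset (Fin m → ZMod 2) :=
  Finset.univ.filter fun x => ofSign t h x = 4 ∨ ofSign t h x = -4

/-- The functions compatible with a plane sum for `(α, β)` whose sign function is `h`. -/
def compatible {m : ℕ} (r t : ℕ) (α : ZMod 2) (h : BoolFun m) : Finset (BoolFun (m + 1)) :=
  Finset.univ.filter fun g => (fun x => g (Fin.cons 0 x)) ∈ reedMuller m r ∧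
    (∀ x, g (Fin.cons 1 x) =
      g (Fin.cons 0 x) + if ofSign t h x = 2 ∨ ofSign t h x = -2 then 1 else 0) ∧
    ∀ x ∈ extremePoints t h, g (Fin.cons 0 x) = α

/-- The first half determines `g`. It is determined by its values on the translate by `v` of the
information set, and those at extreme points are forced to be `α`. -/
theorem card_compatible_le {m : ℕ} (r t : ℕ) (α : ZMod 2) (h : BoolFun m) (v : Fin m → ZMod 2) :
    (compatible r t α h).card ≤
      2 ^ ((smallSets m r).filter fun S => point S + v ∉ extremePoints t h).card := by
  have key : ∀ c d : ZMod 2, (c = 1 ↔ d = 1) → c = d := by decide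
  rw [← Finset.card_powerset]
  refine Finset.card_le_card_of_injOn (fun g => ((smallSets m r).filter fun S =>
    point S + v ∉ extremePoints t h).filter fun S => g (Fin.cons 0 (point S + v)) = 1) ?_ ?_
  · intro g _
    simp only [Finset.coe_powerset, Set.mem_preimage, Set.mem_powerset_iff, Finset.coe_subset]
    exact Finset.filter_subset _ _
  · intro g hg g' hg' heq
    simp only [compatible, Finset.coe_filter, Finset.mem_univ, true_and, Set.mem_ofPred_eq] at hg hg'
    obtain ⟨h1, h2, h3⟩ := hg
    obtain ⟨h1', h2', h3'⟩ := hg'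
    have h4 := eq_of_eq_on_points (translate_mem_reedMuller h1 v) (translate_mem_reedMuller h1' v)
      (by
        intro S hS
        by_cases hP : point S + v ∈ extremePoints t h
        · exact (h3 _ hP).trans (h3' _ hP).symm
        · have := Finset.ext_iff.1 heq S
          simp only [Finset.mem_filter, mem_smallSets, hS, hP, not_false_eq_true, true_and]
            at this
          exact key _ _ this)
    have h5 : ∀ x, g (Fin.cons 0 x) = g' (Fin.cons 0 x) := by
      intro x
      simpa using congrFun h4 (x - v)
    rw [← glue_eq g, ← glue_eq g']
    simp only [h2, h2', h5]

/-- Every agreement point is extreme for one of the four pairs `(α, β)`; pigeonhole selects a pair.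
-/
theorem exists_compatible {s : ℕ} {f : BoolFun (2 * s + 2)} (hf : f.IsBent)
    (i : Fin (2 * s + 2)) {g : BoolFun (2 * s + 1)} (hg : coordDerivative i f = g)
    (h0 : (fun x => g (Fin.cons 0 x)) ∈ reedMuller (2 * s) s) :
    ∃ α, ∃ h ∈ reedMuller (2 * s) (s + 1), g ∈ compatible s (s + 1) α h ∧
      (agreement g).card ≤ 4 * (extremePoints (s + 1) h).card := by
  choose h hh hE using fun p : ZMod 2 × ZMod 2 => hf.exists_sign i p.1 p.2
  have hgc : ∀ q x, g (Fin.cons q x) = f (insertTwo i 0 q x) + f (insertTwo i 1 q x) := by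
    intro q x
    rw [← hg, coordDerivative_cons]
  have hsub : agreement g ⊆ Finset.univ.biUnion fun p => extremePoints (s + 1) (h p) := by
    intro x hx
    rw [agreement, Finset.mem_filter, hgc, hgc] at hx
    obtain ⟨α, β, hαβ⟩ := exists_four_signs _ _ _ _ hx.2
    simp only [Finset.mem_biUnion, Finset.mem_univ, true_and]
    refine ⟨(α, β), ?_⟩
    simpa [extremePoints, ← hE, planeSum_eq] using hαβ
  have hcard := (Finset.card_le_card hsub).trans Finset.card_biUnion_le
  obtain ⟨p, hp⟩ : ∃ p, (agreement g).card ≤ 4 * (extremePoints (s + 1) (h p)).card := by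
    by_contra! hc
    have h1 := Finset.sum_lt_sum_of_nonempty
      (Finset.univ_nonempty (α := ZMod 2 × ZMod 2)) fun p _ => hc p
    rw [← Finset.mul_sum, Finset.sum_const, Finset.card_univ] at h1
    simp only [Fintype.card_prod, ZMod.card, smul_eq_mul] at h1
    omega
  refine ⟨p.1, h p, hh p, ?_, hp⟩
  have h4 := fun x => four_signs (f (insertTwo i 0 0 x)) (f (insertTwo i 0 1 x))
    (f (insertTwo i 1 0 x)) (f (insertTwo i 1 1 x)) p.1 p.2
  simp only [← planeSum_eq, hE, ← hgc] at h4
  simp only [compatible, Finset.mem_filter, Finset.mem_univ, true_and]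
  refine ⟨h0, fun x => (h4 x).1, fun x hx => (h4 x).2 ?_⟩
  simpa [extremePoints] using hx

/-- If the halves of `g` agree often then `g` belongs to a small set attached to few data. -/
theorem card_derivatives_le {s : ℕ} (G : Finset (BoolFun (2 * s + 1)))
    (hG : ∀ g ∈ G, (fun x => g (Fin.cons 0 x)) ∈ reedMuller (2 * s) s ∧
      2 ^ (2 * s) ≤ 2 * (agreement g).card ∧
      ∃ (i : Fin (2 * s + 2)) (f : BoolFun (2 * s + 2)), f.IsBent ∧ coordDerivative i f = g) :
    G.card ≤ 2 ^ (1 + (smallSets (2 * s) (s + 1)).card + 2 * s +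
      7 * (smallSets (2 * s) s).card / 8) := by
  let D : Finset (ZMod 2 × BoolFun (2 * s) × (Fin (2 * s) → ZMod 2)) :=
    Finset.univ ×ˢ reedMuller (2 * s) (s + 1) ×ˢ Finset.univ
  let k : BoolFun (2 * s) × (Fin (2 * s) → ZMod 2) → ℕ := fun p =>
    ((smallSets (2 * s) s).filter fun S => point S + p.2 ∉ extremePoints (s + 1) p.1).card
  let C : ZMod 2 × BoolFun (2 * s) × (Fin (2 * s) → ZMod 2) → Finset (BoolFun (2 * s + 1)) :=
    fun p => if k p.2 ≤ 7 * (smallSets (2 * s) s).card / 8 then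
      compatible s (s + 1) p.1 p.2.1 else ∅
  have hsub : G ⊆ D.biUnion C := by
    intro g hg
    obtain ⟨h0, ha, i, f, hf, hfg⟩ := hG g hg
    obtain ⟨α, h, hh, hc, hP⟩ := exists_compatible hf i hfg h0
    obtain ⟨v, hv⟩ := exists_large_translate (extremePoints (s + 1) h) (smallSets (2 * s) s) point
    rw [Finset.mem_biUnion]
    refine ⟨(α, h, v), by simp [D, hh], ?_⟩
    simp only [C]
    rw [if_pos]
    · exact hc
    · have h1 := Finset.card_filter_add_card_filter_not (s := smallSets (2 * s) s)
        (fun S => point S + v ∈ extremePoints (s + 1) h)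
      rw [Fintype.card_fun, ZMod.card, Fintype.card_fin] at hv
      -- Density `1/2` of agreement, divided among four pairs, gives the `1/8`.
      have h2 : (smallSets (2 * s) s).card ≤ 8 *
          ((smallSets (2 * s) s).filter fun S => point S + v ∈ extremePoints (s + 1) h).card := by
        refine Nat.le_of_mul_le_mul_left (c := 2 ^ (2 * s)) ?_ (by positivity)
        nlinarith
      simp only [k]
      omega
  refine (Finset.card_le_card hsub).trans
    ((Finset.card_biUnion_le_card_mul D C (2 ^ (7 * (smallSets (2 * s) s).card / 8)) ?_).trans ?_)
  · intro p _
    simp only [C]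
    split_ifs with hk
    · exact (card_compatible_le _ _ _ _ p.2.2).trans (Nat.pow_le_pow_right (by norm_num) hk)
    · simp
  · simp only [D, Finset.card_product, Finset.card_univ, ZMod.card, card_reedMuller,
      Fintype.card_fun, Fintype.card_fin]
    rw [pow_add _ _ (7 * _ / 8), pow_add _ _ (2 * s), pow_add, pow_one,
      ← mul_assoc]

/-! ### Many balanced functions -/

/-- The number of points where `f` takes the value `1`. -/
def weight {n : ℕ} (f : BoolFun n) : ℕ := (Finset.univ.filter fun x => f x = 1).card

theorem card_zeros_add_weight {n : ℕ} (f : BoolFun n) :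
    (Finset.univ.filter fun x => f x = 0).card + weight f = 2 ^ n := by
  have key : ∀ c : ZMod 2, c = 1 ↔ ¬ c = 0 := by decide
  simp only [weight, key]
  rw [Finset.card_filter_add_card_filter_not, Finset.card_univ]
  simp

theorem isBalanced_iff {n : ℕ} (f : BoolFun n) : f.IsBalanced ↔ 2 * weight f = 2 ^ n := by
  have h := card_zeros_add_weight f
  unfold IsBalanced
  change _ = weight f ↔ _
  omega

theorem weight_add_one {n : ℕ} (f : BoolFun n) : weight (f + 1) + weight f = 2 ^ n := by
  have key : ∀ c : ZMod 2, c + 1 = 1 ↔ c = 0 := by decide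
  rw [← card_zeros_add_weight f]
  simp [weight, key]

theorem weight_glue {n : ℕ} (a b : BoolFun n) : weight (glue a b) = weight a + weight b := by
  have h : ∀ F : ZMod 2 → ℕ, ∑ p, F p = F 0 + F 1 := fun F => Fin.sum_univ_two F
  simp only [weight, Finset.card_filter]
  rw [← (Fin.consEquiv (fun _ => ZMod 2)).sum_comp, Fintype.sum_prod_type, h]
  have h0 : ∀ x, glue a b (Fin.consEquiv (fun _ => ZMod 2) (0, x)) = a x := glue_cons_zero a b
  have h1 : ∀ x, glue a b (Fin.consEquiv (fun _ => ZMod 2) (1, x)) = b x := glue_cons_one a b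
  simp only [h0, h1]

theorem isBalanced_glue {n : ℕ} {a b : BoolFun n} (ha : a.IsBalanced) (hb : b.IsBalanced) :
    (glue a b).IsBalanced := by
  rw [isBalanced_iff] at *
  rw [weight_glue, pow_succ]
  omega

theorem IsBalanced.add_one {n : ℕ} {a : BoolFun n} (ha : a.IsBalanced) : (a + 1).IsBalanced := by
  have := weight_add_one a
  rw [isBalanced_iff] at *
  omega

open Classical in
/-- The balanced functions of degree at most `r`. -/
noncomputable def balancedReedMuller (n r : ℕ) : Finset (BoolFun n) :=
  (reedMuller n r).filter IsBalanced

theorem mem_balancedReedMuller {n r : ℕ} {f : BoolFun n} :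
    f ∈ balancedReedMuller n r ↔ f ∈ reedMuller n r ∧ f.IsBalanced := by
  simp [balancedReedMuller]

theorem exists_large_weight_class (n r : ℕ) : ∃ w, (reedMuller n r).card ≤
    2 ^ (n + 1) * ((reedMuller n r).filter fun f => weight f = w).card := by
  by_contra! hc
  have h1 : ∀ f ∈ reedMuller n r, weight f ∈ Finset.range (2 ^ (n + 1)) := by
    intro f _
    have := card_zeros_add_weight f
    have := Nat.pow_lt_pow_right (a := 2) (by norm_num) (Nat.lt_succ_self n)
    rw [Finset.mem_range]
    exact lt_of_le_of_lt (by omega) this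
  have h2 := Finset.sum_lt_sum_of_nonempty (s := Finset.range (2 ^ (n + 1)))
    (by simp) fun w _ => hc w
  rw [← Finset.mul_sum, ← Finset.card_eq_sum_card_fiberwise h1] at h2
  simp at h2

/-- Gluing one function to the complement of another of equal weight is balanced; a most popular
weight supplies the pairs. -/
theorem card_balancedReedMuller_ge (n r : ℕ) : (reedMuller n r).card ^ 2 ≤
    (2 ^ (n + 1)) ^ 2 * (balancedReedMuller (n + 1) (r + 1)).card := by
  obtain ⟨w, hw⟩ := exists_large_weight_class n r
  refine (Nat.pow_le_pow_left hw 2).trans ?_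
  rw [mul_pow]
  refine Nat.mul_le_mul_left _ ?_
  rw [sq, ← Finset.card_product]
  refine Finset.card_le_card_of_injOn (fun p => glue p.1 (p.2 + 1)) ?_ ?_
  · intro p hp
    simp only [Finset.coe_product, Finset.coe_filter, Set.mem_prod, Set.mem_ofPred_eq] at hp
    obtain ⟨⟨h1, h2⟩, h3, h4⟩ := hp
    rw [Finset.mem_coe, mem_balancedReedMuller, isBalanced_iff, weight_glue, pow_succ]
    refine ⟨glue_mem_reedMuller h1 (add_mem_reedMuller h3 (one_mem_reedMuller _ _)), ?_⟩
    have := weight_add_one p.2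
    omega
  · intro p _ q _ h
    obtain ⟨h1, h2⟩ := glue_injective h
    exact Prod.ext h1 (add_right_cancel h2)

theorem card_agreement_glue_add_one {n : ℕ} (a b : BoolFun n) :
    (agreement (glue a (b + 1))).card + (agreement (glue a b)).card = 2 ^ n := by
  have key : ∀ c d : ZMod 2, c = d + 1 ↔ ¬ c = d := by decide
  simp only [agreement, glue_cons_zero, glue_cons_one, Pi.add_apply, Pi.one_apply, key]
  rw [add_comm, Finset.card_filter_add_card_filter_not, Finset.card_univ]
  simp

/-- The functions with halves that are balanced, of degree at most `r`, and agree at half of the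
points or more. -/
noncomputable def balancedFamily (n r : ℕ) : Finset (BoolFun (n + 1)) :=
  ((balancedReedMuller n r ×ˢ balancedReedMuller n r).image fun p => glue p.1 p.2).filter
    fun g => 2 ^ n ≤ 2 * (agreement g).card

theorem card_balancedFamily_ge (n r : ℕ) :
    (balancedReedMuller n r).card ^ 2 ≤ 2 * (balancedFamily n r).card := by
  let X := (balancedReedMuller n r ×ˢ balancedReedMuller n r).image fun p => glue p.1 p.2
  have hX : X.card = (balancedReedMuller n r).card ^ 2 := by
    rw [Finset.card_image_of_injective, Finset.card_product, sq]
    exact fun p q h => Prod.ext (glue_injective h).1 (glue_injective h).2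
  have h1 := Finset.card_filter_add_card_filter_not (s := X)
    fun g => 2 ^ n ≤ 2 * (agreement g).card
  have h2 : (X.filter fun g => ¬ 2 ^ n ≤ 2 * (agreement g).card).card
      ≤ (balancedFamily n r).card := by
    -- Complementing the second half exchanges agreement and disagreement, and preserves balance and
    -- degree.
    refine Finset.card_le_card_of_injOn (fun g => g + glue 0 1) ?_ ?_
    · intro g hg
      simp only [Finset.coe_filter, Set.mem_ofPred_eq, X, Finset.mem_image, Finset.mem_product]
        at hg
      obtain ⟨⟨⟨a, b⟩, ⟨ha, hb⟩, rfl⟩, h⟩ := hg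
      have h3 : glue a b + glue 0 1 = glue a (b + 1) := by
        funext x
        simp only [glue, Pi.add_apply]
        split_ifs <;> simp
      replace h : ¬ 2 ^ n ≤ 2 * (agreement (glue a b)).card := h
      have h4 := card_agreement_glue_add_one a b
      simp only [h3, Finset.mem_coe, balancedFamily, Finset.mem_filter, Finset.mem_image,
        Finset.mem_product]
      refine ⟨⟨(a, b + 1), ⟨ha, ?_⟩, rfl⟩, by omega⟩
      rw [mem_balancedReedMuller] at hb ⊢
      exact ⟨add_mem_reedMuller hb.1 (one_mem_reedMuller _ _), hb.2.add_one⟩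
    · exact fun _ _ _ _ h => add_right_cancel h
  have h3 : balancedFamily n r = X.filter fun g => 2 ^ n ≤ 2 * (agreement g).card := rfl
  rw [← h3] at h1
  omega

/-! ### Functions with a nonzero period -/

/-- If `v i = 1`, a `v`-invariant function is determined by its restriction to the hyperplane `x i =
0`. -/
theorem card_invariant_le {n r : ℕ} (v : Fin (n + 1) → ZMod 2) (hv : v ≠ 0) :
    ((reedMuller (n + 1) r).filter fun g => ∀ x, g (x + v) = g x).card
      ≤ 2 ^ (smallSets n r).card := by
  have key : ∀ c : ZMod 2, c ≠ 0 → c = 1 := by decide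
  obtain ⟨i, hi⟩ := Function.ne_iff.1 hv
  rw [← card_reedMuller]
  refine Finset.card_le_card_of_injOn (fun g x => g (i.insertNth (0 : ZMod 2) x)) ?_ ?_
  · intro g hg
    exact restrict_mem_reedMuller (Finset.mem_filter.1 hg).1 i
  · intro g hg g' hg' h
    have hg2 := (Finset.mem_filter.1 hg).2
    have hg2' := (Finset.mem_filter.1 hg').2
    have h0 : ∀ x : Fin (n + 1) → ZMod 2, x i = 0 → g x = g' x := by
      intro x hx
      have := congrFun h (i.removeNth x)
      simp only [← hx, Fin.insertNth_self_removeNth] at this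
      exact this
    funext x
    by_cases hx : x i = 0
    · exact h0 x hx
    · rw [← hg2, ← hg2']
      refine h0 _ ?_
      rw [Pi.add_apply, key _ hx, key _ hi]
      rfl

/-- The functions of degree at most `r` that are invariant under some nonzero translation. -/
def invariantFunctions (n r : ℕ) : Finset (BoolFun n) :=
  (reedMuller n r).filter fun g => ∃ v, v ≠ 0 ∧ ∀ x, g (x + v) = g x

theorem card_invariantFunctions_le (n r : ℕ) :
    (invariantFunctions (n + 1) r).card ≤ 2 ^ (n + 1 + (smallSets n r).card) := by
  let V : Finset (Fin (n + 1) → ZMod 2) := Finset.univ.filter fun v => v ≠ 0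
  have hsub : invariantFunctions (n + 1) r ⊆ V.biUnion fun v =>
      (reedMuller (n + 1) r).filter fun g => ∀ x, g (x + v) = g x := by
    intro g hg
    obtain ⟨h1, v, hv, h2⟩ := Finset.mem_filter.1 hg
    simp only [Finset.mem_biUnion, Finset.mem_filter, V, Finset.mem_univ, true_and]
    exact ⟨v, hv, h1, h2⟩
  refine (Finset.card_le_card hsub).trans ((Finset.card_biUnion_le_card_mul _ _
    (2 ^ (smallSets n r).card) fun v hv => card_invariant_le v (Finset.mem_filter.1 hv).2).trans ?_)
  rw [pow_add]
  refine Nat.mul_le_mul_right _ ((Finset.card_le_univ V).trans ?_)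
  simp

/-! ### Binomial estimates -/

theorem card_smallSets (n r : ℕ) :
    (smallSets n r).card = ∑ k ∈ Finset.range (r + 1), n.choose k := by
  have h : ∀ S ∈ smallSets n r, S.card ∈ Finset.range (r + 1) := by
    intro S hS
    have := mem_smallSets.1 hS
    simpa using Nat.lt_succ_of_le this
  rw [Finset.card_eq_sum_card_fiberwise h]
  refine Finset.sum_congr rfl fun k hk => ?_
  rw [Finset.mem_range] at hk
  have hc := Finset.card_powersetCard k (Finset.univ : Finset (Fin n))
  rw [Finset.card_fin] at hc
  rw [← hc]
  congr 1
  ext S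
  simp only [Finset.mem_filter, mem_smallSets, Finset.mem_powersetCard, Finset.subset_univ,
    true_and, and_iff_right_iff_imp]
  omega

theorem two_mul_card_smallSets (s : ℕ) :
    2 * (smallSets (2 * s) s).card = 4 ^ s + s.centralBinom := by
  rw [card_smallSets, ← Nat.sum_range_choose_halfway, Finset.sum_range_succ', Nat.centralBinom]
  have h3 : ∑ k ∈ Finset.range s, (2 * s + 1).choose (k + 1) =
      ∑ k ∈ Finset.range s, (2 * s).choose k + ∑ k ∈ Finset.range s, (2 * s).choose (k + 1) := by
    rw [← Finset.sum_add_distrib]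
    exact Finset.sum_congr rfl fun k _ => Nat.choose_succ_succ _ _
  have h4 := Finset.sum_range_succ' (fun k => (2 * s + 1).choose k) s
  have h1 := Finset.sum_range_succ (fun k => (2 * s).choose k) s
  have h2 := Finset.sum_range_succ' (fun k => (2 * s).choose k) s
  simp only [Nat.choose_zero_right] at h2 h4 ⊢
  omega

theorem card_smallSets_succ_le (s : ℕ) :
    (smallSets (2 * s) (s + 1)).card ≤ (smallSets (2 * s) s).card + s.centralBinom := by
  rw [card_smallSets, card_smallSets, Finset.sum_range_succ]
  exact Nat.add_le_add_left (Nat.choose_le_centralBinom _ _) _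

theorem four_mul_card_smallSets (t : ℕ) :
    4 * (smallSets (2 * t + 3) t).card + 2 * (t + 2).centralBinom = 4 ^ (t + 2) := by
  have h1 := Nat.sum_range_choose_halfway (t + 1)
  rw [Finset.sum_range_succ] at h1
  have h2 : (t + 2).centralBinom = (2 * (t + 1) + 1).choose (t + 1) +
      (2 * (t + 1) + 1).choose (t + 1 + 1) := by
    rw [← Nat.choose_succ_succ, Nat.centralBinom]
    congr 1
  rw [Nat.choose_symm_half] at h2
  rw [card_smallSets, pow_succ 4 (t + 1), h2, ← h1, show 2 * t + 3 = 2 * (t + 1) + 1 by ring]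
  ring

/-- The induction step reduces to `(2s+1)(2s+3) ≤ 4(s+1)²`. -/
theorem centralBinom_sq_mul_le (s : ℕ) : s.centralBinom ^ 2 * (2 * s + 1) ≤ 16 ^ s := by
  induction s with
  | zero => simp
  | succ s ih =>
    have h := Nat.succ_mul_centralBinom_succ s
    refine Nat.le_of_mul_le_mul_left (c := (s + 1) ^ 2) ?_ (by positivity)
    calc (s + 1) ^ 2 * ((s + 1).centralBinom ^ 2 * (2 * (s + 1) + 1))
        = ((s + 1) * (s + 1).centralBinom) ^ 2 * (2 * s + 3) := by ring
      _ = (s.centralBinom ^ 2 * (2 * s + 1)) * (4 * (2 * s + 1) * (2 * s + 3)) := by rw [h]; ring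
      _ ≤ 16 ^ s * (4 * (2 * s + 1) * (2 * s + 3)) := Nat.mul_le_mul_right _ ih
      _ ≤ 16 ^ s * (16 * (s + 1) ^ 2) := Nat.mul_le_mul_left _ (by nlinarith)
      _ = (s + 1) ^ 2 * 16 ^ (s + 1) := by ring

theorem mul_centralBinom_le {s : ℕ} (hs : 8192 ≤ s) : 128 * s.centralBinom ≤ 4 ^ s := by
  have h := centralBinom_sq_mul_le s
  have h16 : (16 : ℕ) ^ s = (4 ^ s) ^ 2 := by rw [← pow_mul, mul_comm, pow_mul]; norm_num
  rw [h16] at h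
  refine (Nat.pow_le_pow_iff_left (n := 2) (by norm_num)).1 (le_trans ?_ h)
  rw [mul_pow, mul_comm]
  -- The threshold on `s` comes from `128² = 16384 ≤ 2s + 1`.
  exact Nat.mul_le_mul_left _ (by omega)

theorem mul_lt_four_pow {s : ℕ} (hs : 8192 ≤ s) : 8192 * s < 4 ^ s := by
  have h : (4 : ℕ) ^ s = 2 ^ s * 2 ^ s := by rw [← mul_pow]; norm_num
  have := Nat.lt_two_pow_self (n := s)
  rw [h]
  nlinarith

/-! ### Comparison of the counts and Tokareva's conjecture -/

theorem exists_not_derivative {s : ℕ} (hs : 8192 ≤ s) :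
    ∃ g : BoolFun (2 * s + 1), g ∈ reedMuller (2 * s + 1) s ∧ g.IsBalanced ∧
      (∀ (i : Fin (2 * s + 2)) (f : BoolFun (2 * s + 2)), f.IsBent → coordDerivative i f ≠ g) ∧
      ∀ v, (∀ x, g (x + v) = g x) → v = 0 := by
  classical
  -- The halves have degree at most `s - 1 = t + 1`; balanced ones are obtained by gluing functions
  -- of degree at most `t` in `2s - 1 = 2t + 3` variables.
  obtain ⟨t, rfl⟩ : ∃ t, s = t + 2 := ⟨s - 2, by omega⟩
  set s := t + 2 with hst
  set G := balancedFamily (2 * s) (t + 1) with hGdef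
  have hmem : ∀ g ∈ G, (fun x => g (Fin.cons 0 x)) ∈ reedMuller (2 * s) s ∧
      2 ^ (2 * s) ≤ 2 * (agreement g).card ∧ g ∈ reedMuller (2 * s + 1) s ∧ g.IsBalanced := by
    intro g hg
    obtain ⟨h1, h2⟩ := Finset.mem_filter.1 hg
    obtain ⟨⟨a, b⟩, hab, rfl⟩ := Finset.mem_image.1 h1
    obtain ⟨ha, hb⟩ := Finset.mem_product.1 hab
    rw [mem_balancedReedMuller] at ha hb
    refine ⟨?_, h2, glue_mem_reedMuller ha.1 hb.1, isBalanced_glue ha.2 hb.2⟩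
    simp only [glue_cons_zero]
    exact reedMuller_mono (Nat.le_succ _) ha.1
  by_contra! hc
  let D := G.filter fun g => ∃ (i : Fin (2 * s + 2)) (f : BoolFun (2 * s + 2)),
    f.IsBent ∧ coordDerivative i f = g
  have hsub : G ⊆ D ∪ invariantFunctions (2 * s + 1) s := by
    intro g hg
    obtain ⟨-, -, h3, h4⟩ := hmem g hg
    rw [Finset.mem_union]
    by_cases hD : ∃ (i : Fin (2 * s + 2)) (f : BoolFun (2 * s + 2)),
        f.IsBent ∧ coordDerivative i f = g
    · exact Or.inl (Finset.mem_filter.2 ⟨hg, hD⟩)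
    · push Not at hD
      obtain ⟨v, h5, h6⟩ := hc g h3 h4 hD
      exact Or.inr (Finset.mem_filter.2 ⟨h3, v, h6, h5⟩)
  have hD := card_derivatives_le D fun g hg => by
    obtain ⟨h1, h2⟩ := Finset.mem_filter.1 hg
    exact ⟨(hmem g h1).1, (hmem g h1).2.1, h2⟩
  have hI := card_invariantFunctions_le (2 * s) s
  have hcard := (Finset.card_le_card hsub).trans (Finset.card_union_le _ _)
  have hbal := card_balancedReedMuller_ge (2 * t + 3) t
  have hfam := card_balancedFamily_ge (2 * s) (t + 1)
  rw [show 2 * t + 3 + 1 = 2 * s by omega, card_reedMuller] at hbal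
  have h1 := two_mul_card_smallSets s
  have h2 := card_smallSets_succ_le s
  have h3 := four_mul_card_smallSets t
  have h4 := mul_centralBinom_le hs
  have h5 := mul_lt_four_pow hs
  set b := (smallSets (2 * s) s).card
  set b' := (smallSets (2 * s) (s + 1)).card
  set d := (smallSets (2 * t + 3) t).card
  rw [← hst] at h3
  have hbb' : b ≤ b' := Finset.card_le_card fun S hS => by
    rw [mem_smallSets] at *
    omega
  set e := 1 + b' + 2 * s + 7 * b / 8 with he
  have h6 : G.card ≤ 2 ^ (e + 1) := by
    have : 2 ^ (2 * s + 1 + b) ≤ 2 ^ e := Nat.pow_le_pow_right (by norm_num) (by omega)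
    rw [pow_succ]
    omega
  have h7 : (2 : ℕ) ^ (4 * d) ≤ 2 ^ (8 * s + 1 + (e + 1)) := by
    calc (2 : ℕ) ^ (4 * d) = ((2 ^ d) ^ 2) ^ 2 := by rw [← pow_mul, ← pow_mul]; congr 1; ring
      _ ≤ ((2 ^ (2 * s)) ^ 2 * (balancedReedMuller (2 * s) (t + 1)).card) ^ 2 :=
        Nat.pow_le_pow_left hbal 2
      _ = 2 ^ (8 * s) * (balancedReedMuller (2 * s) (t + 1)).card ^ 2 := by
        rw [mul_pow, ← pow_mul, ← pow_mul]
        congr 2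
        ring
      _ ≤ 2 ^ (8 * s) * (2 * 2 ^ (e + 1)) :=
        Nat.mul_le_mul_left _ (hfam.trans (Nat.mul_le_mul_left _ h6))
      _ = 2 ^ (8 * s + 1 + (e + 1)) := by ring
  have h8 := (Nat.pow_le_pow_iff_right (by norm_num)).1 h7
  -- By `h3`, `4d` is `4^s` minus two central binomials, while `e` is about `15/16 · 4^s`; `h4` and
  -- `h5` keep the error terms below the gap `4^s / 16`.
  omega

/-- The counterexample is `glue g g`. A derivative in direction `a` has period `a`, so `hinv` leaves
only `a = 0`, where the derivative vanishes and is not balanced, and the first basis vector,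
excluded by `hder`. -/
theorem not_tokarevaConjecture {s : ℕ} {g : BoolFun (2 * s + 1)}
    (hdeg : g ∈ reedMuller (2 * s + 1) s) (hbal : g.IsBalanced)
    (hder : ∀ f : BoolFun (2 * s + 2), f.IsBent → coordDerivative 0 f ≠ g)
    (hinv : ∀ v, (∀ x, g (x + v) = g x) → v = 0) : ¬ TokarevaConjecture (2 * s + 2) := by
  intro hT
  have hg : ∀ x, glue g g x = g (Fin.tail x) := fun x => ite_self _
  have hbal' : (glue g g).IsBalanced := isBalanced_glue hbal hbal
  have hd : (glue g g).algebraicDegree ≤ (2 * s + 2) / 2 - 1 := by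
    rw [algebraicDegree_le_iff, show (2 * s + 2) / 2 - 1 = s by omega]
    exact glue_self_mem_reedMuller hdeg
  obtain ⟨f, a, hf, hfa⟩ := hT (glue g g) hbal' hd
    ⟨Pi.single 0 1, by simp, fun x => by
      rw [hg, hg]
      congr 1
      funext j
      simp [Fin.tail]⟩
  have haa : a + a = 0 := funext fun _ => CharTwo.add_self_eq_zero _
  have htail : Fin.tail a = 0 := by
    refine hinv _ fun x => ?_
    have h1 : ∀ y, glue g g (y + a) = glue g g y := by
      intro y
      rw [hfa]
      unfold derivative
      rw [add_assoc y, haa, add_zero, add_comm]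
    have h2 := h1 (Fin.cons 0 x)
    rw [hg, hg, Fin.tail_cons] at h2
    exact h2
  have ha : a = Fin.cons (a 0) 0 := by rw [← htail, Fin.cons_self_tail]
  have key : ∀ c : ZMod 2, c = 0 ∨ c = 1 := by decide
  rcases key (a 0) with h0 | h0
  · have hz : glue g g = 0 := by
      rw [hfa]
      funext x
      have : a = 0 := by
        rw [ha, h0]
        funext j
        refine Fin.cases ?_ (fun j => ?_) j <;> simp
      simp [derivative, this, CharTwo.add_self_eq_zero]
    rw [hz, isBalanced_iff] at hbal'
    simp only [weight, Pi.zero_apply, zero_ne_one, Finset.filter_false, Finset.card_empty,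
      mul_zero] at hbal'
    exact absurd hbal' (by positivity)
  · have hs : a = Pi.single 0 1 := by
      rw [ha, h0]
      funext j
      refine Fin.cases ?_ (fun j => ?_) j <;> simp
    refine hder f hf (funext fun z => ?_)
    unfold coordDerivative
    rw [← hs, ← hfa, hg, Fin.insertNth_zero', Fin.tail_cons]

end BoolFun

theorem theorem1 :
    ∃ N : ℕ, ∀ n : ℕ, N ≤ n → Even (n + 1) →
      (∃ g : BoolFun n, g.IsBalanced ∧ g.algebraicDegree ≤ (n + 1) / 2 - 1 ∧
        ∀ (i : Fin (n + 1)) (f : BoolFun (n + 1)), f.IsBent → BoolFun.coordDerivative i f ≠ g) ∧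
      ¬ BoolFun.TokarevaConjecture (n + 1) := by
  refine ⟨2 * 8192 + 1, fun n hn he => ?_⟩
  obtain ⟨s, rfl⟩ : ∃ s, n = 2 * s + 1 := by
    obtain ⟨k, hk⟩ := he
    exact ⟨k - 1, by omega⟩
  obtain ⟨g, hdeg, hbal, hder, hinv⟩ := BoolFun.exists_not_derivative (s := s) (by omega)
  refine ⟨⟨g, hbal, ?_, hder⟩, BoolFun.not_tokarevaConjecture hdeg hbal (hder 0) hinv⟩
  rw [BoolFun.algebraicDegree_le_iff, show (2 * s + 1 + 1) / 2 - 1 = s by omega]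
  exact hdeg
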